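/- Let $G$ be a torsion-free group (not necessarily abelian, written multiplicatively), let $2\le \ell\le m$ be integers, and let $\mathcal A=(A_1,\dots,A_m)$ be a sequence of finite subsets of $G$ with $|A_i|\ge 2$ for every $i$. Put $A=A_1\cup\dots\cup A_m$ and, for $a\in A$, $\mu(a)=\min\bigl(\ell,\,|\{i : a\in A_i\}|\bigr)$. Let $$\Pi^{\ell}(\mathcal A)=\{a_{1}\cdots a_{\ell} : a_j\in A_{i_j},\ i_1,\dots,i_\ell\in\{1,\dots,m\}\text{ pairwise distinct, in any order}\}.$$ For $\alpha,g,\beta\in G$ with $g\ne 1$, a nonempty finite set $S\subseteq G$ is called a geometric progression of type $(\alpha,g,\beta)$ if $S=\{\alpha\beta,\alpha g\beta,\dots,\alpha g^{|S|-1}\beta\}$. The sequence $\mathcal A$ is called $(\ell,g)$-minimizing if $g\neq 1$ and there are sets $B_1,\dots,B_\ell\subseteq A$ such that 1. $|B_i|\ge 2$ for $i=1,\dots,\ell$; 2. there are $\alpha_i,\beta_i\in G$ such that $B_i$ is a geometric progression of type $(\alpha_i,g,\beta_i)$ for $i=1,\dots,\ell$, and $\alpha_{i+1}=\beta_i^{-1}$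 for $i=1,\dots,\ell-1$; 3. $\mu(a)=|\{j : a\in B_j\}|$ for every $a\in A$; 4. $B_1\cdots B_\ell=\Pi^\ell(\mathcal A)$, where $B_1\cdots B_\ell=\{b_1\cdots b_\ell : b_j\in B_j\}$. **Theorem.** The equality $$|\Pi^{\ell}(\mathcal A)|=\sum_{a\in A}\mu(a)-\ell+1\qquad(*)$$ holds if and only if $\mathcal A$ is $(\ell,g)$-minimizing for some $g\in G$. Moreover, if $(*)$ holds, then there are $g\in G$ with $g\ne 1$ and $\alpha_1,\beta_1,\dots,\alpha_m,\beta_m\in G$ such that, with $M=\{a\in A:\mu(a)=\ell\}$, the set $A_i\cup M$ is a geometric progression of type $(\alpha_i,g,\beta_i)$ for every $i=1,\dots,m$. -/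

import Mathlib

/-- The product set `A₁ ⋯ A_n` (in this order) of a finite sequence of finite subsets of `G`. -/
def productSet {G : Type*} [Group G] [DecidableEq G] {n : ℕ} (A : Fin n → Finset G) : Finset G :=
  (Fintype.piFinset A).image fun a => (List.ofFn a).prod

theorem mem_productSet {G : Type*} [Group G] [DecidableEq G] {n : ℕ} (A : Fin n → Finset G)
    (x : G) : x ∈ productSet A ↔ ∃ a : Fin n → G, (∀ i, a i ∈ A i) ∧ (List.ofFn a).prod = x := by
  simp [productSet]

/-- The generalized product set `Π^ℓ(𝒜)`: all products `a₁ ⋯ a_ℓ` with `a_j ∈ A_{i_j}`, where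
`(i₁, …, i_ℓ)` runs over all sequences of `ℓ` distinct indices, in any order. -/
def genProductSet {G : Type*} [Group G] [DecidableEq G] {m : ℕ} (ℓ : ℕ) (A : Fin m → Finset G) :
    Finset G :=
  ((Finset.univ : Finset (Fin ℓ → Fin m)).filter fun i => Function.Injective i).biUnion
    fun i => productSet fun j => A (i j)

theorem mem_genProductSet {G : Type*} [Group G] [DecidableEq G] {m : ℕ} (ℓ : ℕ)
    (A : Fin m → Finset G) (x : G) :
    x ∈ genProductSet ℓ A ↔ ∃ i : Fin ℓ → Fin m, Function.Injective i ∧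
      ∃ a : Fin ℓ → G, (∀ j, a j ∈ A (i j)) ∧ (List.ofFn a).prod = x := by
  simp [genProductSet, mem_productSet]

/-- The union `A₁ ∪ ⋯ ∪ A_m`. -/
def unionSet {G : Type*} [DecidableEq G] {m : ℕ} (A : Fin m → Finset G) : Finset G :=
  Finset.univ.biUnion A

/-- `μ(a) = min (ℓ, ∑ j, χ_{A_j}(a))`. -/
def truncMult {G : Type*} [DecidableEq G] {m : ℕ} (ℓ : ℕ) (A : Fin m → Finset G) (a : G) : ℕ :=
  min ℓ (∑ j, if a ∈ A j then 1 else 0)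

/-- The set `M` of all `a ∈ A₁ ∪ ⋯ ∪ A_m` with `μ(a) = ℓ`. -/
def fullMultSet {G : Type*} [DecidableEq G] {m : ℕ} (ℓ : ℕ) (A : Fin m → Finset G) : Finset G :=
  (unionSet A).filter fun a => truncMult ℓ A a = ℓ

/-- `S` is a geometric progression of type `(a, g, b)`:
`S` is nonempty, `g ≠ 1`, and `S = {ab, agb, …, ag^(|S|-1)b}`. -/
def IsGeomProgOfType {G : Type*} [Group G] [DecidableEq G] (S : Finset G) (a g b : G) : Prop :=
  S.Nonempty ∧ g ≠ 1 ∧ S = (Finset.range S.card).image fun k => a * g ^ k * b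

/-- `𝒜 = (A₁, …, A_m)` is an `(ℓ, g)`-minimizing sequence of sets. -/
def IsMinimizingSeq {G : Type*} [Group G] [DecidableEq G] {m : ℕ} (ℓ : ℕ) (g : G)
    (A : Fin m → Finset G) : Prop :=
  g ≠ 1 ∧ ∃ B : Fin ℓ → Finset G,
    (∀ i, B i ⊆ unionSet A) ∧
    (∀ i, 2 ≤ (B i).card) ∧
    (∃ α β : Fin ℓ → G,
      (∀ i, IsGeomProgOfType (B i) (α i) g (β i)) ∧
      ∀ i j : Fin ℓ, (j : ℕ) = (i : ℕ) + 1 → α j = (β i)⁻¹) ∧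
    (∀ a ∈ unionSet A, truncMult ℓ A a = ∑ j, if a ∈ B j then 1 else 0) ∧
    productSet B = genProductSet ℓ A

/-!
The inequality `|Π^ℓ| ≥ ∑ μ(a) - ℓ + 1`, of which the theorem describes the equality case, comes
from uncrossing. Replacing two sets `A p`, `A q` by `A p ∪ A q` and `A p ∩ A q` keeps every
multiplicity and does not enlarge `Π^ℓ` (`uncross_pair`). Doing this as long as possible between `ℓ
- 1` chosen sets and the sets outside a chosen `ℓ`-element index set, and then merging what is left
outside into the remaining chosen set `A i₀`, yields sets `B₁, …, B_ℓ` with the truncated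
multiplicities `μ`, with `B₁ ⋯ B_ℓ ⊆ Π^ℓ`, and with `B₁ = A i₀ ∪ M` (`exists_selection`).
Kemperman's inequality `|X Y| ≥ |X| + |Y| - 1` then gives `|Π^ℓ| ≥ ∑ |B_i| - ℓ + 1`, and the sum is
`∑ μ(a)`. In the case of equality, `Π^ℓ = B₁ ⋯ B_ℓ` and Kemperman's inequality is attained at every
step, so the Brailovsky–Freiman theorem (`exists_geomProg_of_critical`) makes the `B_i` progressions
with matching inner factors (`exists_geomProg_of_card_productSet_le`). Conversely, the product of
such progressions is a progression whose length is known.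

For the last assertion, `i₀` is arbitrary. The product `Π^ℓ` is the same progression for each choice
of `i₀`, so appending `{1, h}`, with `h` its ratio, to the factors `B₁ ⋯ B_ℓ` increases the size
only by one. This forces the ratio of `B₂ ⋯ B_ℓ`, and hence that of `B₁ = A i₀ ∪ M`, to be conjugate
to `h` (`exists_geomProg_left_factor`).

Kemperman's inequality is the Cauchy–Davenport theorem for groups without nontrivial finite
subgroups. The proof of the Brailovsky–Freiman theorem reduces a critical pair `(A, B)` to one in
which `A` is minimal for `B`. By submodularity the translates of such an `A` meet in at most one
element, and counting the pairs `(a b, a' b)` in `(A B) × (A B)` excludes `3 ≤ |B| ≤ |A|`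
(`not_critical_of_atom`). If `|B| = 2`, then `A` is a single chain `x, x g, x g², …`
(`eq_geomProg_of_card_mul_pair_le`).
-/

section MinimizingSequences

open Finset
open scoped Pointwise

variable {G : Type*} [Group G] [DecidableEq G]

/-! ### Geometric progressions -/

/-- The geometric progression `{x y, x g y, …, x gⁿ⁻¹ y}`. -/
def geomProg (x g y : G) (n : ℕ) : Finset G :=
  (range n).image fun k => x * g ^ k * y

theorem mem_geomProg {x g y z : G} {n : ℕ} :
    z ∈ geomProg x g y n ↔ ∃ k < n, x * g ^ k * y = z := by
  simp [geomProg]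

theorem geomProg_conj (x g y z : G) (n : ℕ) :
    geomProg x (y * g * y⁻¹) z n = geomProg (x * y) g (y⁻¹ * z) n := by
  simp only [geomProg, conj_pow]
  simp only [mul_assoc]

theorem inv_mul_mul_ne_one {G : Type*} [Group G] {g : G} (hg : g ≠ 1) (y : G) :
    y⁻¹ * g * y ≠ 1 := by
  rwa [Ne, mul_assoc, inv_mul_eq_one, right_eq_mul]

theorem geomProg_inv (x g y : G) (n : ℕ) :
    (geomProg x g y n)⁻¹ = geomProg y⁻¹ g⁻¹ x⁻¹ n := by
  ext z
  simp only [Finset.mem_inv', mem_geomProg]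
  refine exists_congr fun k => and_congr_right fun _ => ?_
  rw [← inv_inj, inv_inv]
  simp [mul_assoc]

theorem geomProg_reverse (x g y : G) (n : ℕ) :
    geomProg x g⁻¹ y n = geomProg (x * g⁻¹ ^ (n - 1)) g y n := by
  have key : ∀ k < n, x * g⁻¹ ^ (n - 1) * g ^ (n - 1 - k) = x * g⁻¹ ^ k := by
    intro k hk
    obtain ⟨j, hj⟩ : ∃ j, n - 1 = k + j := ⟨n - 1 - k, by omega⟩
    rw [show n - 1 - k = j by omega, hj, pow_add]
    simp [mul_assoc]
  ext z
  simp only [mem_geomProg]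
  constructor
  · rintro ⟨k, hk, rfl⟩
    exact ⟨n - 1 - k, by omega, by rw [key k hk]⟩
  · rintro ⟨k, hk, rfl⟩
    refine ⟨n - 1 - k, by omega, ?_⟩
    rw [← key _ (by omega), show n - 1 - (n - 1 - k) = k by omega]

theorem geomProg_mul_geomProg (x g y z : G) {m : ℕ} (hm : 1 ≤ m) (n : ℕ) :
    geomProg x g y m * geomProg y⁻¹ g z (n + 1) = geomProg x g z (m + n) := by
  have key : ∀ i j : ℕ, x * g ^ i * y * (y⁻¹ * g ^ j * z) = x * g ^ (i + j) * z := by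
    intro i j
    simp [pow_add, mul_assoc]
  ext w
  simp only [Finset.mem_mul, mem_geomProg]
  constructor
  · rintro ⟨_, ⟨i, hi, rfl⟩, _, ⟨j, hj, rfl⟩, rfl⟩
    exact ⟨i + j, by omega, (key i j).symm⟩
  · rintro ⟨k, hk, rfl⟩
    refine ⟨_, ⟨min k (m - 1), by omega, rfl⟩, _, ⟨k - min k (m - 1), by omega, rfl⟩, ?_⟩
    rw [key, show min k (m - 1) + (k - min k (m - 1)) = k by omega]

theorem card_geomProg (htf : ∀ x : G, x ≠ 1 → ¬ IsOfFinOrder x) {g : G} (hg : g ≠ 1) (x y : G)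
    (n : ℕ) : (geomProg x g y n).card = n := by
  rw [geomProg, card_image_of_injective, card_range]
  intro i j h
  exact injective_pow_iff_not_isOfFinOrder.2 (htf g hg) (by simpa using h)

/-! ### The theorems of Kemperman and Brailovsky–Freiman -/

theorem card_add_card_le_card_mul_add_one (htf : ∀ x : G, x ≠ 1 → ¬ IsOfFinOrder x)
    {A B : Finset G} (hA : A.Nonempty) (hB : B.Nonempty) :
    A.card + B.card ≤ (A * B).card + 1 := by
  have h := cauchy_davenport_minOrder_mul hA hB
  rw [show Monoid.minOrder G = ⊤ by simpa [Monoid.minOrder] using htf] at h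
  simp only [le_top, inf_of_le_right, Nat.cast_le] at h
  omega

/-- If `A` has only one element `e` with `e g ∉ A`, then it consists of `e, e g⁻¹, e g⁻², …`,
because every chain `a, a g, a g², …` eventually leaves `A` and can do so only at `e`. -/
theorem eq_geomProg_of_card_mul_pair_le (htf : ∀ x : G, x ≠ 1 → ¬ IsOfFinOrder x)
    {A : Finset G} {g : G} (hg : g ≠ 1) (hA : A.Nonempty)
    (h : (A * {1, g}).card ≤ A.card + 1) : ∃ x, A = geomProg x g 1 A.card := by
  have hinj := injective_pow_iff_not_isOfFinOrder.2 (htf g hg)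
  have hexit : ∀ a ∈ A, ∃ k : ℕ, a * g ^ k ∈ A ∧ a * g ^ (k + 1) ∉ A := by
    intro a ha
    by_contra! hcon
    have hall : ∀ k : ℕ, a * g ^ k ∈ A := by
      intro k
      induction k with
      | zero => simpa using ha
      | succ k ih => exact hcon k ih
    exact Set.infinite_of_injective_forall_mem (s := (A : Set G))
      (f := fun k : ℕ => a * g ^ k) (fun i j hij => hinj (by simpa using hij))
      (by simpa using hall) A.finite_toSet
  have huniq : ∀ a ∈ A, ∀ b ∈ A, a * g ∉ A → b * g ∉ A → a = b := by
    intro a ha b hb hag hbg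
    by_contra hab
    have hsub : insert (a * g) (insert (b * g) A) ⊆ A * {1, g} := by
      simp only [insert_subset_iff]
      exact ⟨mul_mem_mul ha (by simp), mul_mem_mul hb (by simp),
        subset_mul_left A (by simp)⟩
    have := card_le_card hsub
    rw [card_insert_of_notMem (by simp [hab, hag]), card_insert_of_notMem hbg] at this
    omega
  obtain ⟨a₀, ha₀⟩ := hA
  obtain ⟨k₀, he, he'⟩ := hexit a₀ ha₀
  set e := a₀ * g ^ k₀ with hedef
  have he1 : e * g ∉ A := by rwa [hedef, mul_assoc, ← pow_succ]
  have hform : ∀ a ∈ A, ∃ k : ℕ, e * g⁻¹ ^ k = a := by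
    intro a ha
    obtain ⟨k, hk, hk'⟩ := hexit a ha
    refine ⟨k, ?_⟩
    rw [← huniq _ hk _ he (by rwa [mul_assoc, ← pow_succ]) he1]
    simp [mul_assoc]
  have hdown : ∀ k : ℕ, e * g⁻¹ ^ (k + 1) ∈ A → e * g⁻¹ ^ k ∈ A := by
    intro k hk
    by_contra hcon
    have h1 := huniq _ hk _ he (by simpa [pow_succ, mul_assoc] using hcon) he1
    exact absurd (hinj (a₁ := k + 1) (a₂ := 0) (by simpa using h1)) (by omega)
  have hdown' : ∀ i j : ℕ, i ≤ j → e * g⁻¹ ^ j ∈ A → e * g⁻¹ ^ i ∈ A := by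
    intro i j hij
    induction j, hij using Nat.le_induction with
    | base => exact id
    | succ j _ ih => exact fun h => ih (hdown j h)
  have hout : ∃ n : ℕ, e * g⁻¹ ^ n ∉ A := by
    by_contra! hcon
    exact Set.infinite_of_injective_forall_mem (s := (A : Set G))
      (f := fun k : ℕ => e * g⁻¹ ^ k) (fun i j hij => hinj (by simpa using hij))
      (by simpa using hcon) A.finite_toSet
  have hAn : A = geomProg e g⁻¹ 1 (Nat.find hout) := by
    ext a
    rw [mem_geomProg]
    constructor
    · intro ha
      obtain ⟨k, rfl⟩ := hform a ha
      refine ⟨k, ?_, by simp⟩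
      by_contra hlt
      exact Nat.find_spec hout (hdown' _ _ (not_lt.1 hlt) ha)
    · rintro ⟨k, hk, rfl⟩
      simpa using Nat.find_min hout hk
  have hcard : A.card = Nat.find hout := by
    conv_lhs => rw [hAn]
    exact card_geomProg htf (inv_ne_one.2 hg) _ _ _
  exact ⟨_, by rw [← geomProg_reverse, hcard]; exact hAn⟩

theorem geomProg_one_two (g : G) : geomProg 1 g 1 2 = {1, g} := by
  ext z
  simp [geomProg, range_add_one, eq_comm, or_comm]

theorem eq_geomProg_of_card_mul_geomProg_le (htf : ∀ x : G, x ≠ 1 → ¬ IsOfFinOrder x)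
    {A : Finset G} {g y : G} {n : ℕ} (hg : g ≠ 1) (hA : A.Nonempty) (hn : 2 ≤ n)
    (h : (A * geomProg 1 g y n).card + 1 ≤ A.card + n) : ∃ x, A = geomProg x g 1 A.card := by
  obtain ⟨k, rfl⟩ : ∃ k, n = 2 + k := ⟨n - 2, by omega⟩
  apply eq_geomProg_of_card_mul_pair_le htf hg hA
  have h1 := geomProg_mul_geomProg 1 g 1 y (m := 2) (by norm_num) k
  rw [geomProg_one_two, inv_one] at h1
  rw [← h1, ← mul_assoc] at h
  have h2 := card_add_card_le_card_mul_add_one htf (A := A * {1, g}) (B := geomProg 1 g y (k + 1))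
    (hA.mul (by simp)) (card_pos.1 (by rw [card_geomProg htf hg]; omega))
  rw [card_geomProg htf hg] at h2
  omega

/-- Let `(A, B)` be critical, `|A B| = |A| + |B| - 1`, and let no `(A', B)` with `2 ≤ |A'| < |A|` be
critical. Then distinct translates of `A` share at most one element, by submodularity of `|A B|`. -/
theorem card_inter_smul_le_one (htf : ∀ x : G, x ≠ 1 → ¬ IsOfFinOrder x) {A B : Finset G}
    (hA : A.Nonempty) (hB : B.Nonempty) (h : (A * B).card + 1 ≤ A.card + B.card)
    (hatom : ∀ A' : Finset G, 2 ≤ A'.card → A'.card < A.card →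
      A'.card + B.card < (A' * B).card + 1) {c : G} (hc : c ≠ 1) :
    (A ∩ c • A).card ≤ 1 := by
  by_contra hcon
  have hne : c • A ≠ A := by
    intro hcA
    obtain ⟨a, ha⟩ := hA
    have hall : ∀ k : ℕ, c ^ k * a ∈ A := by
      intro k
      induction k with
      | zero => simpa using ha
      | succ k ih =>
        rw [← hcA, pow_succ', mul_assoc]
        exact smul_mem_smul_finset ih
    exact Set.infinite_of_injective_forall_mem (s := (A : Set G))
      (f := fun k : ℕ => c ^ k * a)
      (fun i j hij => injective_pow_iff_not_isOfFinOrder.2 (htf c hc) (by simpa using hij))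
      (by simpa using hall) A.finite_toSet
  have hlt : (A ∩ c • A).card < A.card := by
    refine card_lt_card (inter_subset_left.ssubset_of_ne fun heq => hne ?_)
    refine (eq_of_subset_of_card_le (inter_eq_left.1 heq) ?_).symm
    rw [card_smul_finset]
  have h1 := hatom _ (by omega) hlt
  have h2 := card_add_card_le_card_mul_add_one htf (A := A ∪ c • A) (hA.mono subset_union_left) hB
  have h3 : ((A ∩ c • A) * B).card ≤ (A * B ∩ (c • A * B)).card :=
    card_le_card (inter_mul_subset)
  rw [union_mul] at h2
  have h4 := card_union_add_card_inter (A * B) (c • A * B)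
  have h5 := card_union_add_card_inter A (c • A)
  rw [smul_mul_assoc, card_smul_finset] at h4
  rw [card_smul_finset] at h5
  rw [smul_mul_assoc] at h2 h3
  omega

/-- Counting pairs `(a b, a' b)` in `(A B) × (A B)` leaves only `|A| = |B| = 3`, and this case
fails because every element of `A B` has two representations. -/
theorem not_critical_of_atom (htf : ∀ x : G, x ≠ 1 → ¬ IsOfFinOrder x) {A B : Finset G}
    (hB : 3 ≤ B.card) (hBA : B.card ≤ A.card) (h : (A * B).card + 1 ≤ A.card + B.card)
    (hatom : ∀ A' : Finset G, 2 ≤ A'.card → A'.card < A.card →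
      A'.card + B.card < (A' * B).card + 1) : False := by
  have hA0 : A.Nonempty := card_pos.1 (by omega)
  have hB0 : B.Nonempty := card_pos.1 (by omega)
  have hquot : ∀ a ∈ A, ∀ a' ∈ A, ∀ b ∈ A, ∀ b' ∈ A, a ≠ a' → a * a'⁻¹ = b * b'⁻¹ →
      a = b := by
    intro a ha a' ha' b hb b' hb' hne heq
    have hc : a * a'⁻¹ ≠ 1 := fun h => hne (mul_inv_eq_one.1 h)
    refine card_le_one.1 (card_inter_smul_le_one htf hA0 hB0 h hatom hc) a ?_ b ?_
    · exact mem_inter.2 ⟨ha, mem_smul_finset.2 ⟨a', ha', by simp⟩⟩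
    · exact mem_inter.2 ⟨hb, mem_smul_finset.2 ⟨b', hb', by simp [heq]⟩⟩
  have hcount : (A.offDiag ×ˢ B).card ≤ (A * B).offDiag.card := by
    refine card_le_card_of_injOn (fun t => (t.1.1 * t.2, t.1.2 * t.2)) ?_ ?_
    · rintro ⟨⟨a, a'⟩, b⟩ ht
      simp only [mem_coe, mem_product, mem_offDiag] at ht
      simp only [mem_coe, mem_offDiag, ne_eq, mul_left_inj]
      exact ⟨mul_mem_mul ht.1.1 ht.2, mul_mem_mul ht.1.2.1 ht.2, ht.1.2.2⟩
    · rintro ⟨⟨a, a'⟩, b⟩ ht ⟨⟨c, c'⟩, d⟩ ht' heq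
      simp only [mem_coe, mem_product, mem_offDiag] at ht ht'
      simp only [Prod.mk.injEq] at heq
      have hq : a * a'⁻¹ = c * c'⁻¹ := by
        calc a * a'⁻¹ = (a * b) * (a' * b)⁻¹ := by simp [mul_assoc]
          _ = (c * d) * (c' * d)⁻¹ := by rw [heq.1, heq.2]
          _ = c * c'⁻¹ := by simp [mul_assoc]
      obtain rfl := hquot a ht.1.1 a' ht.1.2.1 c ht'.1.1 c' ht'.1.2.1 ht.1.2.2 hq
      obtain rfl : b = d := mul_left_cancel heq.1
      obtain rfl : a' = c' := mul_right_cancel heq.2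
      rfl
  have hrep : 2 * (A * B).card ≤ A.card * B.card := by
    rw [← card_product, ← image_mul_product]
    refine mul_card_image_le_card _ _ fun p hp => ?_
    by_contra hlt
    obtain ⟨⟨a, b⟩, hab, rfl⟩ := mem_image.1 hp
    rw [mem_product] at hab
    have huniq := card_le_one.1 (Nat.le_of_lt_succ (not_le.1 hlt))
    have hsub : A.erase a * B ⊆ (A * B).erase (a * b) := by
      intro z hz
      obtain ⟨a', ha', b', hb', rfl⟩ := mem_mul.1 hz
      rw [mem_erase] at ha'
      refine mem_erase.2 ⟨fun heq => ha'.1 ?_, mul_mem_mul ha'.2 hb'⟩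
      exact congrArg Prod.fst (huniq (a', b') (by simp [ha'.2, hb', heq]) (a, b) (by simp [hab]))
    have h1 := card_le_card hsub
    rw [card_erase_of_mem (mul_mem_mul hab.1 hab.2)] at h1
    have h2 : (A.erase a).card = A.card - 1 := card_erase_of_mem hab.1
    have h3 := hatom (A.erase a) (by omega) (by omega)
    have h4 : 0 < (A * B).card := card_pos.2 (hA0.mul hB0)
    omega
  rw [card_product, offDiag_card, offDiag_card] at hcount
  obtain ⟨P, hP⟩ : ∃ P, (A * B).card = P := ⟨_, rfl⟩
  obtain ⟨u, hu⟩ : ∃ u, B.card = u + 3 := ⟨B.card - 3, by omega⟩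
  obtain ⟨v, hv⟩ : ∃ v, A.card = u + v + 3 := ⟨A.card - B.card, by omega⟩
  have hP0 : P ≤ 2 * u + v + 5 := by omega
  rw [hP, hu, hv] at hcount
  rw [hP, hu, hv] at hrep
  have e1 : (u + v + 3) * (u + v + 3) - (u + v + 3) = (u + v + 3) * (u + v + 2) := by
    rw [Nat.sub_eq_iff_eq_add (by nlinarith)]; ring
  have e2 : P * P - P ≤ (2 * u + v + 5) * (2 * u + v + 4) := by
    rw [Nat.sub_le_iff_le_add]
    rcases Nat.eq_zero_or_pos P with h0 | h0
    · subst h0; simp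
    · obtain ⟨q, rfl⟩ : ∃ q, P = q + 1 := ⟨P - 1, by omega⟩
      nlinarith [Nat.mul_le_mul hP0 (show q ≤ 2 * u + v + 4 by omega)]
  rw [e1] at hcount
  have hmain := hcount.trans e2
  rcases Nat.eq_zero_or_pos u with rfl | hu0
  · rcases Nat.eq_zero_or_pos v with rfl | hv0
    · have hP1 := card_add_card_le_card_mul_add_one htf hA0 hB0
      omega
    · nlinarith
  · nlinarith [mul_pos hu0 hu0, Nat.zero_le (u * v), Nat.zero_le (u * v * v),
      Nat.zero_le (u * u * v), Nat.zero_le (u * u * u)]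

/-- The **Brailovsky–Freiman theorem**: the critical pairs of Kemperman's inequality in a
torsion-free group are the pairs of progressions with a common ratio. -/
theorem exists_geomProg_of_critical (htf : ∀ x : G, x ≠ 1 → ¬ IsOfFinOrder x) {A B : Finset G}
    (hA : 2 ≤ A.card) (hB : 2 ≤ B.card) (h : (A * B).card + 1 ≤ A.card + B.card) :
    ∃ g : G, g ≠ 1 ∧ ∃ x y, A = geomProg x g 1 A.card ∧ B = geomProg 1 g y B.card := by
  induction hN : A.card + B.card using Nat.strong_induction_on generalizing A B with
  | _ N ih =>
  -- Passing to `(B⁻¹, A⁻¹)` allows assuming that `B` is the smaller set.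
  have main : ∀ A B : Finset G, 2 ≤ A.card → 2 ≤ B.card → (A * B).card + 1 ≤ A.card + B.card →
      A.card + B.card = N → B.card ≤ A.card →
      ∃ g : G, g ≠ 1 ∧ ∃ x y, A = geomProg x g 1 A.card ∧ B = geomProg 1 g y B.card := by
    intro A B hA hB h hN hBA
    have hA0 : A.Nonempty := card_pos.1 (by omega)
    rcases hB.eq_or_lt with hB2 | hB3
    · obtain ⟨b, c, hbc, rfl⟩ := card_eq_two.1 hB2.symm
      have hg : c * b⁻¹ ≠ 1 := fun h => hbc (mul_inv_eq_one.1 h).symm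
      have hpair : ({b, c} : Finset G) = {1, c * b⁻¹} * {b} := by
        ext z
        simp [mem_mul, eq_comm]
      obtain ⟨x, hx⟩ := eq_geomProg_of_card_mul_pair_le htf hg hA0 (by
        rw [hpair, ← mul_assoc, card_mul_singleton] at h
        rw [← hpair] at h
        omega)
      refine ⟨_, hg, x, b, hx, ?_⟩
      rw [← hB2]
      ext z
      simp [geomProg, range_add_one, eq_comm, or_comm]
    · by_cases hatom : ∃ A' : Finset G, 2 ≤ A'.card ∧ A'.card < A.card ∧
          (A' * B).card + 1 ≤ A'.card + B.card
      · obtain ⟨A', h2, hlt, hcrit⟩ := hatom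
        obtain ⟨g, hg, -, y, -, hy⟩ := ih _ (by omega) h2 hB hcrit rfl
        rw [hy] at h
        rw [card_geomProg htf hg] at h
        obtain ⟨x, hx⟩ := eq_geomProg_of_card_mul_geomProg_le htf hg hA0 hB h
        exact ⟨g, hg, x, y, hx, hy⟩
      · push Not at hatom
        exact (not_critical_of_atom htf hB3 hBA h hatom).elim
  rcases le_total B.card A.card with hle | hle
  · exact main A B hA hB h hN hle
  · obtain ⟨g, hg, x, y, hx, hy⟩ := main B⁻¹ A⁻¹ (by rwa [card_inv]) (by rwa [card_inv])
      (by rw [← mul_inv_rev, card_inv, card_inv, card_inv]; omega)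
      (by rw [card_inv, card_inv]; omega) (by rwa [card_inv, card_inv])
    refine ⟨g⁻¹, inv_ne_one.2 hg, y⁻¹, x⁻¹, ?_, ?_⟩
    · rw [← inv_inj, hy, geomProg_inv, card_inv]; simp
    · rw [← inv_inj, hx, geomProg_inv, card_inv]; simp

/-! ### Products of several sets -/

theorem productSet_succ {n : ℕ} (B : Fin (n + 1) → Finset G) :
    productSet B = B 0 * productSet fun i => B i.succ := by
  ext x
  simp only [mem_mul, mem_productSet]
  constructor
  · rintro ⟨a, ha, rfl⟩
    exact ⟨a 0, ha 0, _, ⟨fun i => a i.succ, fun i => ha _, rfl⟩, by simp [List.ofFn_succ]⟩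
  · rintro ⟨b, hb, _, ⟨a, ha, rfl⟩, rfl⟩
    exact ⟨Fin.cons b a, Fin.cases hb ha, by simp [List.ofFn_succ]⟩

theorem productSet_nonempty {n : ℕ} {B : Fin n → Finset G} (hB : ∀ i, (B i).Nonempty) :
    (productSet B).Nonempty := by
  choose a ha using hB
  exact ⟨_, (mem_productSet B _).2 ⟨a, ha, rfl⟩⟩

theorem sum_card_add_one_le_card_productSet (htf : ∀ x : G, x ≠ 1 → ¬ IsOfFinOrder x) {n : ℕ}
    {B : Fin n → Finset G} (hB : ∀ i, (B i).Nonempty) :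
    ∑ i, (B i).card + 1 ≤ (productSet B).card + n := by
  induction n with
  | zero => simpa using productSet_nonempty hB
  | succ n ih =>
    have h1 := ih fun i => hB i.succ
    have h2 := card_add_card_le_card_mul_add_one htf (hB 0) (productSet_nonempty fun i => hB i.succ)
    rw [← productSet_succ] at h2
    rw [Fin.sum_univ_succ]
    omega

theorem productSet_geomProg {n : ℕ} {B : Fin n → Finset G} {g : G} {γ : Fin (n + 1) → G}
    (hB : ∀ i, (B i).Nonempty)
    (h : ∀ i, B i = geomProg (γ i.castSucc)⁻¹ g (γ i.succ) (B i).card) :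
    productSet B = geomProg (γ 0)⁻¹ g (γ (Fin.last n)) (∑ i, ((B i).card - 1) + 1) := by
  induction n with
  | zero =>
    ext x
    simp [mem_productSet, geomProg, eq_comm]
  | succ n ih =>
    have h1 := card_pos.2 (hB 0)
    rw [productSet_succ, ih (B := fun i => B i.succ) (γ := fun i => γ i.succ)
      (fun i => hB i.succ) fun i => h i.succ, Fin.sum_univ_succ, h 0]
    refine (geomProg_mul_geomProg _ g _ _ h1 _).trans ?_
    rw [← h 0, Fin.succ_last, Fin.castSucc_zero]
    congr 1
    omega

/-- Equality in Kemperman's inequality for several sets forces progressions with a common ratio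
whose inner factors cancel. -/
theorem exists_geomProg_of_card_productSet_le (htf : ∀ x : G, x ≠ 1 → ¬ IsOfFinOrder x) {n : ℕ}
    {B : Fin (n + 2) → Finset G} (hB : ∀ i, 2 ≤ (B i).card)
    (h : (productSet B).card + (n + 2) ≤ ∑ i, (B i).card + 1) :
    ∃ g : G, g ≠ 1 ∧ ∃ γ : Fin (n + 3) → G,
      ∀ i, B i = geomProg (γ i.castSucc)⁻¹ g (γ i.succ) (B i).card := by
  have hne : ∀ i, (B i).Nonempty := fun i => card_pos.1 (by have := hB i; omega)
  induction n with
  | zero =>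
    have hprod : productSet B = B 0 * B 1 := by
      rw [productSet_succ, productSet_succ]
      have : productSet (fun i : Fin 0 => B i.succ.succ) = 1 := by
        ext x
        simp [mem_productSet, eq_comm]
      rw [this, mul_one]
      rfl
    rw [hprod, Fin.sum_univ_two] at h
    obtain ⟨g, hg, x, y, hx, hy⟩ := exists_geomProg_of_critical htf (hB 0) (hB 1) (by omega)
    refine ⟨g, hg, ![x⁻¹, 1, y], fun i => ?_⟩
    match i with
    | 0 => simpa using hx
    | 1 => simpa using hy
  | succ n ih =>
    have h1 := card_add_card_le_card_mul_add_one htf (hne 0)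
      (productSet_nonempty fun i => hne i.succ)
    have h2 := sum_card_add_one_le_card_productSet htf fun i => hne i.succ
    rw [← productSet_succ] at h1
    rw [Fin.sum_univ_succ] at h
    obtain ⟨g, hg, γ, hγ⟩ := ih (B := fun i => B i.succ) (fun i => hB i.succ) (by omega)
      fun i => hne i.succ
    have hprod := productSet_geomProg (fun i => hne i.succ) hγ
    set N := ∑ i : Fin (n + 2), ((B i.succ).card - 1) + 1 with hN
    have hN2 : 2 ≤ N := by
      have := single_le_sum (f := fun i : Fin (n + 2) => (B i.succ).card - 1)
        (fun i _ => Nat.zero_le _) (mem_univ 0)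
      have := hB (Fin.succ 0)
      omega
    have hcard : (productSet fun i => B i.succ).card = N := by rw [hprod, card_geomProg htf hg]
    -- As a right factor the product of the remaining sets has ratio `γ₀⁻¹ g γ₀`.
    have hconj := geomProg_conj 1 g (γ 0)⁻¹ ((γ 0)⁻¹ * γ (Fin.last _)) N
    rw [one_mul, inv_inv, mul_inv_cancel_left, ← hprod] at hconj
    obtain ⟨x, hx⟩ := eq_geomProg_of_card_mul_geomProg_le htf (A := B 0)
      (g := (γ 0)⁻¹ * g * γ 0) (y := (γ 0)⁻¹ * γ (Fin.last _)) (n := N)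
      (inv_mul_mul_ne_one hg _) (hne 0) hN2 (by rw [hconj, ← productSet_succ]; omega)
    refine ⟨g, hg, Fin.cons (γ 0 * x⁻¹) γ, Fin.cases ?_ fun i => ?_⟩
    · have h3 := geomProg_conj x g (γ 0)⁻¹ 1 (B 0).card
      rw [inv_inv, mul_one] at h3
      rw [h3] at hx
      simpa using hx
    · simpa [Fin.castSucc_succ] using hγ i

/-! ### Uncrossing -/

/-- One uncrossing step: replacing `A p, A q` by `A p ∪ A q, A p ∩ A q` keeps all multiplicities,
and a system of distinct representatives for the new family is one for the old family, possibly
after exchanging the indices `p` and `q`. -/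
theorem uncross_pair {ι κ α : Type*} [Fintype ι] [DecidableEq ι] [DecidableEq α]
    {A A' : ι → Finset α} {p q : ι} (hpq : p ≠ q) (hp : A' p = A p ∪ A q) (hq : A' q = A p ∩ A q)
    (ho : ∀ i, i ≠ p → i ≠ q → A' i = A i) :
    (∀ a, ∑ i, (if a ∈ A' i then 1 else 0) = ∑ i, (if a ∈ A i then 1 else 0)) ∧
    ∀ (i : κ → ι) (a : κ → α), Function.Injective i → (∀ j, a j ∈ A' (i j)) →
      ∃ i' : κ → ι, Function.Injective i' ∧ ∀ j, a j ∈ A (i' j) := by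
  constructor
  · intro a
    have hmem : q ∈ univ.erase p := by simp [hpq.symm]
    rw [← add_sum_erase univ _ (mem_univ p), ← add_sum_erase _ _ hmem,
      ← add_sum_erase univ (fun i => if a ∈ A i then 1 else 0) (mem_univ p),
      ← add_sum_erase _ (fun i => if a ∈ A i then 1 else 0) hmem, ← add_assoc, ← add_assoc]
    congr 1
    · rw [hp, hq]
      by_cases h1 : a ∈ A p <;> by_cases h2 : a ∈ A q <;> simp [h1, h2]
    · refine sum_congr rfl fun i hi => ?_
      simp only [mem_erase, mem_univ, and_true] at hi
      rw [ho i hi.2 hi.1]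
  · intro i a hi ha
    by_cases hgood : ∀ j, i j = p → a j ∈ A p
    · refine ⟨i, hi, fun j => ?_⟩
      by_cases h1 : i j = p
      · rw [h1]; exact hgood j h1
      · by_cases h2 : i j = q
        · have := ha j
          rw [h2, hq] at this
          rw [h2]; exact (mem_inter.1 this).2
        · rw [← ho _ h1 h2]; exact ha j
    · push Not at hgood
      obtain ⟨j₀, hj₀, hnot⟩ := hgood
      refine ⟨fun j => Equiv.swap p q (i j), (Equiv.injective _).comp hi, fun j => ?_⟩
      have haj := ha j
      dsimp only
      by_cases h1 : i j = p
      · obtain rfl : j = j₀ := hi (h1.trans hj₀.symm)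
        rw [h1, hp] at haj
        rw [h1, Equiv.swap_apply_left]
        exact (mem_union.1 haj).resolve_left hnot
      · by_cases h2 : i j = q
        · rw [h2, hq] at haj
          rw [h2, Equiv.swap_apply_right]
          exact (mem_inter.1 haj).1
        · rw [Equiv.swap_apply_of_ne_of_ne h1 h2, ← ho _ h1 h2]
          exact haj

/-- Uncrossing repeatedly makes every `A q` with `q ∈ J` a subset of every `A p` with `p ∈ E`. -/
theorem exists_uncrossed {ι κ α : Type*} [Fintype ι] [DecidableEq ι] [DecidableEq α]
    (E J : Finset ι) (hEJ : Disjoint E J) (A : ι → Finset α) :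
    ∃ A' : ι → Finset α, (∀ p ∈ E, ∀ q ∈ J, A' q ⊆ A' p) ∧ (∀ i, i ∉ J → A i ⊆ A' i) ∧
      (∀ i, i ∉ E → i ∉ J → A' i = A i) ∧
      (∀ a, ∑ i, (if a ∈ A' i then 1 else 0) = ∑ i, (if a ∈ A i then 1 else 0)) ∧
      ∀ (i : κ → ι) (a : κ → α), Function.Injective i → (∀ j, a j ∈ A' (i j)) →
        ∃ i' : κ → ι, Function.Injective i' ∧ ∀ j, a j ∈ A (i' j) := by
  induction hN : ∑ q ∈ J, (A q).card using Nat.strong_induction_on generalizing A with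
  | _ N ih =>
  by_cases hdone : ∀ p ∈ E, ∀ q ∈ J, A q ⊆ A p
  · exact ⟨A, hdone, fun _ _ => Subset.rfl, fun _ _ _ => rfl, fun _ => rfl,
      fun i _ hi ha => ⟨i, hi, ha⟩⟩
  push Not at hdone
  obtain ⟨p, hpE, q, hqJ, hnot⟩ := hdone
  have hpJ : p ∉ J := fun h => disjoint_left.1 hEJ hpE h
  have hqE : q ∉ E := fun h => disjoint_left.1 hEJ h hqJ
  have hpq : p ≠ q := fun h => hpJ (h ▸ hqJ)
  set A₁ := Function.update (Function.update A p (A p ∪ A q)) q (A p ∩ A q) with hA₁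
  have h1p : A₁ p = A p ∪ A q := by simp [hA₁, hpq]
  have h1q : A₁ q = A p ∩ A q := by simp [hA₁]
  have h1o : ∀ i, i ≠ p → i ≠ q → A₁ i = A i := fun i hip hiq => by simp [hA₁, hip, hiq]
  obtain ⟨hmult, hsdr⟩ := uncross_pair (κ := κ) hpq h1p h1q h1o
  have hlt : ∑ i ∈ J, (A₁ i).card < N := by
    rw [← hN]
    refine sum_lt_sum (fun i hi => ?_) ⟨q, hqJ, ?_⟩
    · by_cases hiq : i = q
      · subst hiq
        rw [h1q]
        exact card_le_card inter_subset_right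
      · rw [h1o i (fun h => hpJ (h ▸ hi)) hiq]
    · rw [h1q]
      refine card_lt_card (inter_subset_right.ssubset_of_ne fun h => hnot ?_)
      exact inter_eq_right.1 h
  obtain ⟨A', hnest, hsub, hout, hmult', hsdr'⟩ := ih _ hlt A₁ rfl
  refine ⟨A', hnest, fun i hi => ?_, fun i hiE hiJ => ?_, fun a => (hmult' a).trans (hmult a),
    fun i a hi ha => ?_⟩
  · refine Subset.trans ?_ (hsub i hi)
    by_cases hip : i = p
    · subst hip
      rw [h1p]
      exact subset_union_left
    · rw [h1o i hip fun h => hi (h ▸ hqJ)]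
  · rw [hout i hiE hiJ, h1o i (fun h => hiE (h ▸ hpE)) fun h => hiJ (h ▸ hqJ)]
  · obtain ⟨i', hi', ha'⟩ := hsdr' i a hi ha
    exact hsdr i' a hi' ha'

/-- There are `ℓ` sets with the truncated multiplicities of the sequence `A` whose product lies in
`Π^ℓ(A)`, and the first of them can be made the union of any prescribed `A i₀` with the set of
elements of full multiplicity. -/
theorem exists_selection {m n : ℕ} (hnm : n + 1 ≤ m) (A : Fin m → Finset G) (i₀ : Fin m) :
    ∃ B : Fin (n + 1) → Finset G,
      B 0 = A i₀ ∪ fullMultSet (n + 1) A ∧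
      (∀ j, B j ⊆ unionSet A) ∧
      (∀ j, ∃ i, A i ⊆ B j) ∧
      (∀ a ∈ unionSet A, truncMult (n + 1) A a = ∑ j, if a ∈ B j then 1 else 0) ∧
      productSet B ⊆ genProductSet (n + 1) A := by
  obtain ⟨e, he, he0⟩ : ∃ e : Fin (n + 1) → Fin m, Function.Injective e ∧ e 0 = i₀ :=
    ⟨fun j => Equiv.swap (Fin.castLE hnm 0) i₀ (Fin.castLE hnm j),
      (Equiv.injective _).comp (Fin.castLE_injective hnm), Equiv.swap_apply_left _ _⟩
  set R : Finset (Fin m) := univ.image e with hR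
  have heR : ∀ j, e j ∈ R := fun j => mem_image_of_mem _ (mem_univ j)
  obtain ⟨A', hnest, hsub, hout, hmult, hsdr⟩ := exists_uncrossed (κ := Fin (n + 1))
    (R.erase i₀) (univ \ R) (disjoint_left.2 fun i hi hi' =>
      (mem_sdiff.1 hi').2 (mem_of_mem_erase hi)) A
  have h0 : A' i₀ = A i₀ := hout i₀ (by simp) (by simp [← he0, heR])
  have hnest' : ∀ j, j ≠ 0 → ∀ q, q ∉ R → A' q ⊆ A' (e j) := fun j hj q hq =>
    hnest _ (mem_erase.2 ⟨fun h => hj (he (h.trans he0.symm)), heR j⟩) q (by simp [hq])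
  have hunion : ∀ i, A' i ⊆ unionSet A := by
    intro i a ha
    by_contra hcon
    have hzero : ∑ i, (if a ∈ A i then 1 else 0) = 0 := by
      refine sum_eq_zero fun i _ => if_neg fun h => hcon ?_
      exact mem_biUnion.2 ⟨i, mem_univ i, h⟩
    rw [← hmult a, sum_eq_zero_iff] at hzero
    have := hzero i (mem_univ i)
    simp [ha] at this
  have hsum : ∀ a, ∑ j, (if a ∈ A' (e j) then 1 else 0) = ∑ i ∈ R, if a ∈ A' i then 1 else 0 :=
    fun a => (sum_image (f := fun i => if a ∈ A' i then 1 else 0) he.injOn).symm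
  have hsumR : ∀ a, ∑ i ∈ R, (if a ∈ A' i then 1 else 0) + ∑ i ∈ univ \ R,
      (if a ∈ A' i then 1 else 0) = ∑ i, if a ∈ A i then 1 else 0 := fun a => by
    rw [← hmult a, add_comm, sum_sdiff (subset_univ R)]
  set B : Fin (n + 1) → Finset G :=
    Fin.cons (A' i₀ ∪ (univ \ R).biUnion A') fun j => A' (e j.succ) with hBdef
  have hB0 : B 0 = A' i₀ ∪ (univ \ R).biUnion A' := rfl
  have hBs : ∀ j : Fin n, B j.succ = A' (e j.succ) := fun j => rfl
  -- Elements of some `A' q` with `q` outside the range of `e` lie in all sets of `B`; for the other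
  -- elements no multiplicity is lost.
  have hcount : ∀ a, truncMult (n + 1) A a = ∑ j, if a ∈ B j then 1 else 0 := by
    intro a
    by_cases ha : ∃ q, q ∉ R ∧ a ∈ A' q
    · obtain ⟨q, hqR, haq⟩ := ha
      have hall : ∀ j, a ∈ B j := by
        refine Fin.cases ?_ fun j => ?_
        · exact mem_union_right _ (mem_biUnion.2 ⟨q, by simp [hqR], haq⟩)
        · exact hnest' _ (Fin.succ_ne_zero j) q hqR haq
      have h1 : n ≤ ∑ i ∈ R, if a ∈ A' i then 1 else 0 := by
        rw [← hsum, Fin.sum_univ_succ]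
        refine le_trans ?_ (Nat.le_add_left _ _)
        rw [sum_congr rfl fun j _ => if_pos (hall j.succ)]
        simp
      have h2 : 1 ≤ ∑ i ∈ univ \ R, if a ∈ A' i then 1 else 0 := by
        refine le_trans (le_of_eq ?_) (single_le_sum (fun i _ => Nat.zero_le _)
          (show q ∈ univ \ R by simp [hqR]))
        rw [if_pos haq]
      rw [sum_congr rfl fun j _ => if_pos (hall j), truncMult, ← hsumR a,
        min_eq_left (by omega)]
      simp
    · push Not at ha
      have h1 : ∑ i ∈ univ \ R, (if a ∈ A' i then 1 else 0) = 0 :=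
        sum_eq_zero fun i hi => if_neg (ha i (mem_sdiff.1 hi).2)
      have h2 : ∀ j, (a ∈ B j) = (a ∈ A' (e j)) := by
        refine Fin.cases ?_ fun j => rfl
        rw [he0, hB0, mem_union, mem_biUnion, eq_iff_iff, or_iff_left]
        rintro ⟨q, hq, haq⟩
        exact ha q (mem_sdiff.1 hq).2 haq
      simp only [h2]
      rw [hsum a, truncMult, ← hsumR a, h1, add_zero]
      refine min_eq_right ?_
      rw [← hsum a]
      refine (sum_le_card_nsmul _ _ 1 fun j _ => ?_).trans (by simp)
      split_ifs <;> omega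
  have hBunion : ∀ j, B j ⊆ unionSet A :=
    Fin.cases (union_subset (hunion _) (biUnion_subset.2 fun i _ => hunion i)) fun j => hunion _
  have hfull : ∀ a, a ∈ fullMultSet (n + 1) A ↔ ∀ j, a ∈ B j := by
    intro a
    rw [fullMultSet, mem_filter, hcount a]
    constructor
    · rintro ⟨-, h⟩
      by_contra! hcon
      obtain ⟨j, hj⟩ := hcon
      have hlt : ∑ j, (if a ∈ B j then 1 else 0) < ∑ _j : Fin (n + 1), 1 := by
        refine sum_lt_sum (fun i _ => ?_) ⟨j, mem_univ j, by simp [hj]⟩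
        split_ifs <;> omega
      simp [h] at hlt
    · intro h
      exact ⟨hBunion 0 (h 0), by rw [sum_congr rfl fun j _ => if_pos (h j)]; simp⟩
  refine ⟨B, ?_, hBunion, ?_, fun a _ => hcount a, ?_⟩
  · ext a
    rw [mem_union, hfull]
    constructor
    · intro ha
      rw [hB0, h0] at ha
      refine (mem_union.1 ha).imp_right fun hq => ?_
      obtain ⟨q, hq, haq⟩ := mem_biUnion.1 hq
      refine Fin.cases (mem_union_right _ (mem_biUnion.2 ⟨q, hq, haq⟩)) fun j => ?_
      exact hnest' _ (Fin.succ_ne_zero j) q (mem_sdiff.1 hq).2 haq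
    · rintro (ha | ha)
      · exact mem_union_left _ (h0 ▸ ha)
      · exact ha 0
  · refine Fin.cases ⟨i₀, ?_⟩ fun j => ⟨e j.succ, hsub _ (by simp [heR])⟩
    rw [hB0, h0]
    exact subset_union_left
  · intro x hx
    obtain ⟨a, ha, rfl⟩ := (mem_productSet B x).1 hx
    obtain ⟨i, hi, hai⟩ : ∃ i : Fin (n + 1) → Fin m, Function.Injective i ∧
        ∀ j, a j ∈ A' (i j) := by
      rcases mem_union.1 (ha 0) with ha0 | ha0
      · exact ⟨e, he, Fin.cases (he0 ▸ ha0) fun j => ha j.succ⟩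
      · obtain ⟨q, hq, haq⟩ := mem_biUnion.1 ha0
        refine ⟨Fin.cons q fun j => e j.succ, Fin.cons_injective_iff.2 ⟨?_, ?_⟩,
          Fin.cases haq fun j => ha j.succ⟩
        · rintro ⟨j, rfl⟩
          exact (mem_sdiff.1 hq).2 (heR _)
        · exact he.comp (Fin.succ_injective n)
    obtain ⟨i', hi', ha'⟩ := hsdr i a hi hai
    exact (mem_genProductSet _ A _).2 ⟨i', hi', a, ha', rfl⟩

/-! ### Sequences attaining equality -/

theorem sum_eq_sum_card {α : Type*} [DecidableEq α] {n : ℕ} {U : Finset α}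
    {B : Fin n → Finset α} {μ : α → ℕ}
    (hB : ∀ j, B j ⊆ U) (hμ : ∀ a ∈ U, μ a = ∑ j, if a ∈ B j then 1 else 0) :
    ∑ a ∈ U, μ a = ∑ j, (B j).card := by
  rw [sum_congr rfl hμ, sum_comm]
  refine sum_congr rfl fun j _ => ?_
  rw [← card_filter, filter_mem_eq_inter, inter_eq_right.2 (hB j)]

/-- If `Π^ℓ(A)` has the minimal size, then it is the product of the sets from
`exists_selection`. -/
theorem exists_critical_selection (htf : ∀ x : G, x ≠ 1 → ¬ IsOfFinOrder x) {m n : ℕ}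
    (hnm : n + 1 ≤ m) {A : Fin m → Finset G} (hA : ∀ i, 2 ≤ (A i).card)
    (h : (genProductSet (n + 1) A).card + (n + 1) =
      ∑ a ∈ unionSet A, truncMult (n + 1) A a + 1) (i₀ : Fin m) :
    ∃ B : Fin (n + 1) → Finset G,
      B 0 = A i₀ ∪ fullMultSet (n + 1) A ∧
      (∀ j, B j ⊆ unionSet A) ∧
      (∀ j, 2 ≤ (B j).card) ∧
      (∀ a ∈ unionSet A, truncMult (n + 1) A a = ∑ j, if a ∈ B j then 1 else 0) ∧
      productSet B = genProductSet (n + 1) A ∧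
      (productSet B).card + (n + 1) = ∑ j, (B j).card + 1 := by
  obtain ⟨B, hB0, hBU, hAB, hμ, hsub⟩ := exists_selection hnm A i₀
  have h2 : ∀ j, 2 ≤ (B j).card := fun j => by
    obtain ⟨i, hi⟩ := hAB j
    exact (hA i).trans (card_le_card hi)
  have hlow := sum_card_add_one_le_card_productSet htf (B := B) fun j =>
    card_pos.1 (by have := h2 j; omega)
  have hsum := sum_eq_sum_card hBU hμ
  have hle := card_le_card hsub
  exact ⟨B, hB0, hBU, h2, hμ, eq_of_subset_of_card_le hsub (by omega), by omega⟩

theorem isMinimizingSeq_of_card_eq (htf : ∀ x : G, x ≠ 1 → ¬ IsOfFinOrder x) {m n : ℕ}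
    (hnm : n + 2 ≤ m) {A : Fin m → Finset G} (hA : ∀ i, 2 ≤ (A i).card)
    (h : (genProductSet (n + 2) A).card + (n + 2) =
      ∑ a ∈ unionSet A, truncMult (n + 2) A a + 1) :
    ∃ g : G, IsMinimizingSeq (n + 2) g A := by
  obtain ⟨B, -, hBU, h2, hμ, hprod, hcard⟩ :=
    exists_critical_selection htf hnm hA h ⟨0, by omega⟩
  obtain ⟨g, hg, γ, hγ⟩ := exists_geomProg_of_card_productSet_le htf h2 hcard.le
  refine ⟨g, hg, B, hBU, h2, ⟨fun i => (γ i.castSucc)⁻¹, fun i => γ i.succ, fun i => ?_,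
    fun i j hij => ?_⟩, hμ, hprod⟩
  · exact ⟨card_pos.1 (by have := h2 i; omega), hg, hγ i⟩
  · have : j.castSucc = i.succ := Fin.ext (by simpa using hij)
    simp only [this]

/-- In a minimizing sequence `Π^ℓ(A)` is itself a progression. -/
theorem IsMinimizingSeq.exists_genProductSet_eq {m n : ℕ} {g : G} {A : Fin m → Finset G}
    (h : IsMinimizingSeq (n + 1) g A) :
    ∃ (x y : G) (N : ℕ), genProductSet (n + 1) A = geomProg x g y N ∧
      N + (n + 1) = ∑ a ∈ unionSet A, truncMult (n + 1) A a + 1 := by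
  obtain ⟨-, B, hBU, h2, ⟨α, β, hprog, hαβ⟩, hμ, hprod⟩ := h
  have hne : ∀ i, (B i).Nonempty := fun i => (hprog i).1
  have hB : ∀ i, B i = geomProg ((Fin.cons (α 0)⁻¹ β : Fin (n + 2) → G) i.castSucc)⁻¹ g
      ((Fin.cons (α 0)⁻¹ β : Fin (n + 2) → G) i.succ) (B i).card := by
    intro i
    have hα : ((Fin.cons (α 0)⁻¹ β : Fin (n + 2) → G) i.castSucc)⁻¹ = α i := by
      cases i using Fin.cases with
      | zero => simp
      | succ i =>
        rw [Fin.castSucc_succ, Fin.cons_succ]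
        exact (hαβ i.castSucc i.succ (by simp)).symm
    rw [hα, Fin.cons_succ]
    exact (hprog i).2.2
  refine ⟨_, _, _, hprod ▸ productSet_geomProg hne hB, ?_⟩
  rw [sum_eq_sum_card hBU hμ]
  have : ∑ i, (B i).card = ∑ i, ((B i).card - 1) + (n + 1) := by
    rw [sum_congr rfl fun i _ => (Nat.sub_add_cancel (card_pos.2 (hne i))).symm,
      sum_add_distrib]
    simp
  omega

/-- Let `(B, C)` be critical and let `|B C {1, h}| ≤ |B C| + 1`. By Kemperman's inequality
`|C {1, h}| ≤ |C| + 1`, so `C` is a progression with ratio `h`, and `B` is one as well, up to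
conjugating the ratio. -/
theorem exists_geomProg_left_factor (htf : ∀ x : G, x ≠ 1 → ¬ IsOfFinOrder x) {B C : Finset G}
    {h : G} (hh : h ≠ 1) (hB : B.Nonempty) (hC : 2 ≤ C.card)
    (hcrit : (B * C).card + 1 ≤ B.card + C.card)
    (hP : (B * C * {1, h}).card ≤ (B * C).card + 1) :
    ∃ x y, B = geomProg x h y B.card := by
  have hC0 : C.Nonempty := card_pos.1 (by omega)
  have h1 := card_add_card_le_card_mul_add_one htf hB (hC0.mul (insert_nonempty 1 {h}))
  rw [← mul_assoc] at h1
  obtain ⟨x, hx⟩ := eq_geomProg_of_card_mul_pair_le htf hh hC0 (by omega)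
  have hconj := geomProg_conj 1 h x x C.card
  rw [one_mul, inv_mul_cancel, ← hx] at hconj
  obtain ⟨y, hy⟩ := eq_geomProg_of_card_mul_geomProg_le htf (A := B) (g := x * h * x⁻¹) (y := x)
    (n := C.card) (fun h => hh (conj_eq_one_iff.1 h)) hB hC (by rw [hconj]; exact hcrit)
  rw [geomProg_conj] at hy
  exact ⟨_, _, hy⟩

theorem exists_geomProg_union_fullMultSet (htf : ∀ x : G, x ≠ 1 → ¬ IsOfFinOrder x) {m n : ℕ}
    (hnm : n + 2 ≤ m) {A : Fin m → Finset G} (hA : ∀ i, 2 ≤ (A i).card)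
    (h : (genProductSet (n + 2) A).card + (n + 2) =
      ∑ a ∈ unionSet A, truncMult (n + 2) A a + 1) :
    ∃ g : G, g ≠ 1 ∧ ∀ i, ∃ x y, IsGeomProgOfType (A i ∪ fullMultSet (n + 2) A) x g y := by
  obtain ⟨g, hmin⟩ := isMinimizingSeq_of_card_eq htf hnm hA h
  have hg := hmin.1
  obtain ⟨x, y, N, hprog, -⟩ := hmin.exists_genProductSet_eq
  have hh : y⁻¹ * g * y ≠ 1 := inv_mul_mul_ne_one hg y
  -- Written with the ratio on the right, `Π` is a progression with ratio `y⁻¹ g y`.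
  have hconj := geomProg_conj (x * y) g y⁻¹ 1 N
  rw [mul_inv_cancel_right, inv_inv, mul_one, ← hprog] at hconj
  refine ⟨_, hh, fun i => ?_⟩
  obtain ⟨B, hB0, -, h2, -, hprod, hcard⟩ := exists_critical_selection htf hnm hA h i
  have hne : ∀ i, (B i).Nonempty := fun i => card_pos.1 (by have := h2 i; omega)
  have hlow := sum_card_add_one_le_card_productSet htf fun j => hne (Fin.succ j)
  rw [Fin.sum_univ_succ] at hcard
  have hC : 2 ≤ (productSet fun j => B (Fin.succ j)).card := by
    have := card_nsmul_le_sum univ (fun j => (B (Fin.succ j)).card) 2 fun j _ => h2 _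
    simp only [card_univ, Fintype.card_fin, smul_eq_mul] at this
    omega
  obtain ⟨α, β, hαβ⟩ := exists_geomProg_left_factor htf hh (hne 0) hC
    (by rw [← productSet_succ]; omega) (by
      rw [← productSet_succ, hprod, ← hconj]
      rcases Nat.eq_zero_or_pos N with h0 | h0
      · simp [h0, geomProg]
      · have h3 := geomProg_mul_geomProg (x * y) (y⁻¹ * g * y) 1 1 h0 1
        rw [inv_one, geomProg_one_two] at h3
        rw [h3, card_geomProg htf hh, card_geomProg htf hh])
  rw [hB0] at hαβ
  exact ⟨α, β, (hB0 ▸ hne 0 :), hh, hαβ⟩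

end MinimizingSequences

theorem theorem1p10 {G : Type*} [Group G] [DecidableEq G]
    (htf : ∀ x : G, x ≠ 1 → ¬ IsOfFinOrder x)
    (ℓ m : ℕ) (hℓ : 2 ≤ ℓ) (hℓm : ℓ ≤ m)
    (A : Fin m → Finset G) (hA : ∀ i, 2 ≤ (A i).card) :
    (((genProductSet ℓ A).card : ℤ) = (∑ a ∈ unionSet A, (truncMult ℓ A a : ℤ)) - (ℓ : ℤ) + 1 ↔
      ∃ g : G, IsMinimizingSeq ℓ g A) ∧
    (((genProductSet ℓ A).card : ℤ) = (∑ a ∈ unionSet A, (truncMult ℓ A a : ℤ)) - (ℓ : ℤ) + 1 →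
      ∃ g : G, g ≠ 1 ∧ ∃ α β : Fin m → G,
        ∀ i, IsGeomProgOfType (A i ∪ fullMultSet ℓ A) (α i) g (β i)) := by
  obtain ⟨n, rfl⟩ : ∃ n, ℓ = n + 2 := ⟨ℓ - 2, by omega⟩
  have hiff : ((genProductSet (n + 2) A).card : ℤ) =
        (∑ a ∈ unionSet A, (truncMult (n + 2) A a : ℤ)) - ((n + 2 : ℕ) : ℤ) + 1 ↔
      (genProductSet (n + 2) A).card + (n + 2) =
        ∑ a ∈ unionSet A, truncMult (n + 2) A a + 1 := by
    rw [← Nat.cast_sum]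
    omega
  rw [hiff]
  refine ⟨⟨isMinimizingSeq_of_card_eq htf hℓm hA, ?_⟩, fun h => ?_⟩
  · rintro ⟨g, hmin⟩
    obtain ⟨x, y, N, hprog, hN⟩ := hmin.exists_genProductSet_eq
    rw [hprog, card_geomProg htf hmin.1]
    exact hN
  · obtain ⟨g, hg, hp⟩ := exists_geomProg_union_fullMultSet htf hℓm hA h
    choose α β hαβ using hp
    exact ⟨g, hg, α, β, hαβ⟩
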